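/- Let $\mathcal H$ be a separable, infinite-dimensional complex Hilbert space with projective space $\mathbb P(\mathcal H)$ (the pure states $[\psi]$), let $(Z,\mathcal X)$ be an uncountable standard Borel space, and for each $[\psi]\in\mathbb P(\mathcal H)$ let $\mu_{[\psi]}$ be a probability measure without atoms on $Z$. Let $\Omega$ be the set of all (possibly unbounded) self-adjoint operators on $\mathcal H$ and $\Omega_b\subset\Omega$ the set of the bounded ones. For $A\in\Omega_b$ with spectral family $\{E^A_{(-\infty,r]}\}_{r\in\mathbb R}$ (for bounded $A$, the operator $E^A_{(-\infty,r]}$ is the orthogonal projection onto the null space of the positive part of $A-r$) and a unit vector $\psi$, put $F^A_\psi(r)=\langle\psi,E^A_{(-\infty,r]}\psi\rangle$; let $\nu_{F^A_\psi}$ be its Lebesgue–Stieltjes measure, i.e. the Borel measure on $\mathbb R$ with $\nu_{F^A_\psi}(]a,b])=F^A_\psi(b)-F^A_\psi(a)$ for $a\le b$, and let $(F^A_\psi)^{(-1)}:\,]0,1[\,\to\mathbb R$, $(F^A_\psi)^{(-1)}(s)=\min\{r: F^A_\psi(r)\ge s\}$, be its quasi-inverse. These depend only on $A$ and $[\psi]$.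 A barrier for $[\psi]$ is a Borel function $Z\to\,]0,1[$ that pushes $\mu_{[\psi]}$ forward to Lebesgue measure on $]0,1[$. A complex of barriers is a family $\alpha=\{\alpha^A_{[\psi]}\}_{A\in\Omega,\,[\psi]\in\mathbb P(\mathcal H)}$ in which each $\alpha^A_{[\psi]}$ is a barrier for $[\psi]$. It defines, for $A\in\Omega_b$, the function $\widehat A_\alpha:\mathbb P(\mathcal H)\times Z\to\mathbb R$, $\widehat A_\alpha([\psi],z)=(F^A_\psi)^{(-1)}\bigl(\alpha^A_{[\psi]}(z)\bigr)$. A representation of $\Omega_b$ on $(Z,\mathcal X,\mu_\cdot)$ is a map $A\mapsto\widetilde A$ from $\Omega_b$ to $\mathbb R^{\mathbb P(\mathcal H)\times Z}$ such that for all $A\in\Omega_b$ and $[\psi]\in\mathbb P(\mathcal H)$ the function $\widetilde A_{[\psi]}=\widetilde A([\psi],\cdot)$ is Borel and $\mu_{[\psi]}$-essentially bounded, and $(\widetilde A_{[\psi]})_*\mu_{[\psi]}=\nu_{F^A_\psi}$. **Theorem.** For every representation $A\mapsto\widetilde A$ of $\Omega_b$ on $(Z,\mathcal X,\mu_\cdot)$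 there exists a complex of barriers $\alpha$ such that, for every $A\in\Omega_b$ and every $[\psi]\in\mathbb P(\mathcal H)$, $\widetilde A([\psi],z)=\widehat A_\alpha([\psi],z)$ for $\mu_{[\psi]}$-almost every $z\in Z$. -/

import Mathlib

open MeasureTheory Filter Topology Set
open scoped InnerProductSpace LinearAlgebra.Projectivization

noncomputable section

namespace QuantumBarrier

/-! ### Observables and their spectral families -/

section Observables

variable {H : Type*} [NormedAddCommGroup H] [InnerProductSpace ℂ H] [CompleteSpace H]

/-- The family `Ω` of all (possibly unbounded) self-adjoint operators on `H`. Mathlib's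
self-adjointness of a partially defined operator entails that its domain is dense. -/
abbrev Observable (H : Type*) [NormedAddCommGroup H] [InnerProductSpace ℂ H] [CompleteSpace H] :=
  {A : H →ₗ.[ℂ] H // IsSelfAdjoint A}

/-- The subfamily `Ω_b` of the bounded self-adjoint operators. -/
abbrev BddObservable (H : Type*) [NormedAddCommGroup H] [InnerProductSpace ℂ H]
    [CompleteSpace H] :=
  {A : H →L[ℂ] H // IsSelfAdjoint A}

/-- The inclusion of `Ω_b` in `Ω`: a bounded operator is regarded as an operator with domain `H`. -/
def BddObservable.toObservable (A : BddObservable H) : Observable H :=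
  ⟨(A.1 : H →ₗ[ℂ] H).toPMap ⊤, by
    rw [LinearPMap.isSelfAdjoint_def,
      ContinuousLinearMap.toPMap_adjoint_eq_adjoint_toPMap_of_dense _ (by simp)]
    rw [ContinuousLinearMap.isSelfAdjoint_iff'.mp A.2]⟩

/-- The positive part `(A - r)⁺` of `A - r`, by the continuous functional calculus. -/
def shiftedPosPart (A : BddObservable H) (r : ℝ) : H →L[ℂ] H :=
  cfc (fun x : ℝ => max (x - r) 0) A.1

/-- The null space of `(A - r)⁺`. -/
def spectralSubspace (A : BddObservable H) (r : ℝ) : Submodule ℂ H :=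
  LinearMap.ker (shiftedPosPart A r : H →ₗ[ℂ] H)

instance (A : BddObservable H) (r : ℝ) : CompleteSpace (spectralSubspace A r) :=
  (ContinuousLinearMap.isClosed_ker (shiftedPosPart A r)).completeSpace_coe

/-- The spectral family of `A`: the spectral projection `E_{(-∞, r]}` of `A` is the orthogonal
projection onto the null space of `(A - r)⁺`. -/
def spectralProj (A : BddObservable H) (r : ℝ) : H →L[ℂ] H :=
  (spectralSubspace A r).starProjection

/-- The mean value `⟨T⟩_ψ` of `T` in the pure state `[ψ]`, namely `⟨ψ, T ψ⟩ / ‖ψ‖²`, that is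
`⟨ψ, T ψ⟩` when `ψ` is a unit representative. -/
def meanValue (T : H →L[ℂ] H) : ℙ ℂ H → ℝ :=
  Projectivization.lift
    (fun ψ : {v : H // v ≠ 0} => (⟪(ψ : H), T ψ⟫_ℂ).re / ‖(ψ : H)‖ ^ 2) (by
      rintro ⟨a, ha⟩ ⟨b, hb⟩ t h
      simp only at h
      subst h
      have ht : t ≠ 0 := fun h0 => ha (by simp [h0])
      have ht' : ‖t‖ ^ 2 ≠ 0 := by positivity
      simp only [map_smul, inner_smul_left, inner_smul_right, ← mul_assoc, mul_pow, norm_smul]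
      rw [mul_comm t, Complex.conj_mul']
      rw [show ((‖t‖ : ℂ) ^ 2 * ⟪b, T b⟫_ℂ).re = ‖t‖ ^ 2 * (⟪b, T b⟫_ℂ).re by
        rw [← Complex.ofReal_pow, Complex.re_ofReal_mul], mul_div_mul_left _ _ ht'])

/-! Monotonicity and right continuity of the distribution functions. -/

lemma continuous_shiftedPosPart (A : BddObservable H) : Continuous (shiftedPosPart A) := by
  refine Metric.continuous_iff.2 fun r ε hε => ⟨ε / 2, by positivity, fun s hs => ?_⟩
  have hA : IsSelfAdjoint A.1 := A.2
  have hle : ‖shiftedPosPart A s - shiftedPosPart A r‖ ≤ ε / 2 := by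
    unfold shiftedPosPart
    rw [← cfc_sub (fun x : ℝ => max (x - s) 0) (fun x : ℝ => max (x - r) 0) A.1]
    refine norm_cfc_le (by positivity) fun x _ => ?_
    have h1 := abs_max_sub_max_le_abs (x - s) (x - r) 0
    rw [Real.norm_eq_abs]
    rw [Real.dist_eq, abs_sub_comm] at hs
    have h2 : x - s - (x - r) = r - s := by ring
    rw [h2] at h1
    linarith
  rw [dist_eq_norm]
  linarith

lemma spectralSubspace_mono (A : BddObservable H) : Monotone (spectralSubspace A) := by
  intro r s hrs
  rcases hrs.eq_or_lt with rfl | hlt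
  · exact le_rfl
  have hA : IsSelfAdjoint A.1 := A.2
  have hpos : ∀ x : ℝ, max (x - r) (s - r) ≠ 0 := fun x =>
    (lt_of_lt_of_le (sub_pos.2 hlt) (le_max_right _ _)).ne'
  have hg : Continuous fun x : ℝ => max (x - s) 0 / max (x - r) (s - r) :=
    Continuous.div (by fun_prop) (by fun_prop) hpos
  have hfac : shiftedPosPart A s =
      cfc (fun x : ℝ => max (x - s) 0 / max (x - r) (s - r)) A.1 * shiftedPosPart A r := by
    unfold shiftedPosPart
    rw [← cfc_mul (fun x : ℝ => max (x - s) 0 / max (x - r) (s - r))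
      (fun x : ℝ => max (x - r) 0) A.1 hg.continuousOn (by fun_prop)]
    refine cfc_congr fun x _ => ?_
    rcases le_total x s with h | h
    · simp [max_eq_right (sub_nonpos.2 h)]
    · have h1 : 0 ≤ x - s := sub_nonneg.2 h
      have h2 : s - r ≤ x - r := by linarith
      have h3 : 0 < x - r := by linarith
      simp only [max_eq_left h1, max_eq_left h2, max_eq_left h3.le]
      field_simp
  intro x hx
  have hx' : shiftedPosPart A r x = 0 := hx
  change shiftedPosPart A s x = 0
  rw [hfac]
  change cfc _ A.1 (shiftedPosPart A r x) = 0
  rw [hx', map_zero]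

lemma meanValue_spectralProj (A : BddObservable H) (ψ : H) (hψ : ψ ≠ 0) (r : ℝ) :
    meanValue (spectralProj A r) (Projectivization.mk ℂ ψ hψ) =
      ‖spectralProj A r ψ‖ ^ 2 / ‖ψ‖ ^ 2 := by
  change (⟪ψ, (spectralSubspace A r).starProjection ψ⟫_ℂ).re / ‖ψ‖ ^ 2 = _
  rw [← Submodule.starProjection_eq_self_iff.2
    (Submodule.starProjection_apply_mem (spectralSubspace A r) ψ),
    ← Submodule.inner_starProjection_left_eq_right, inner_self_eq_norm_sq_to_K]
  norm_cast

lemma meanValue_spectralProj_mono (A : BddObservable H) (p : ℙ ℂ H) :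
    Monotone fun r => meanValue (spectralProj A r) p := by
  induction p with | h ψ hψ =>
  intro r s hrs
  simp only [meanValue_spectralProj]
  have h : spectralProj A r ψ = spectralProj A r (spectralProj A s ψ) :=
    (DFunLike.congr_fun (Submodule.starProjection_comp_starProjection_of_le
      (spectralSubspace_mono A hrs)) ψ).symm
  have : ‖spectralProj A r ψ‖ ≤ ‖spectralProj A s ψ‖ := by
    rw [h]
    exact Submodule.norm_starProjection_apply_le _ _
  gcongr

lemma tendsto_spectralProj (A : BddObservable H) (ψ : H) (r : ℝ) :
    Tendsto (fun n : ℕ => spectralProj A (r + 1 / ((n : ℝ) + 1)) ψ) atTop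
      (𝓝 (spectralProj A r ψ)) := by
  set K : ℕ → Submodule ℂ H := fun n => spectralSubspace A (r + 1 / ((n : ℝ) + 1)) with hK
  have hanti : Antitone K := fun m n hmn => spectralSubspace_mono A (by gcongr)
  have hlim : Tendsto (fun n : ℕ => r + 1 / ((n : ℝ) + 1)) atTop (𝓝 r) := by
    simpa using tendsto_const_nhds.add (tendsto_one_div_add_atTop_nhds_zero_nat (𝕜 := ℝ))
  have hinf : ⨅ n, K n = spectralSubspace A r := by
    refine le_antisymm (fun x hx => ?_) (le_iInf fun n => spectralSubspace_mono A ?_)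
    · have h0 : ∀ n : ℕ, shiftedPosPart A (r + 1 / ((n : ℝ) + 1)) x = 0 := fun n =>
        (Submodule.mem_iInf K).1 hx n
      have h1 : Tendsto (fun n : ℕ => shiftedPosPart A (r + 1 / ((n : ℝ) + 1)) x) atTop
          (𝓝 (shiftedPosPart A r x)) :=
        (((ContinuousLinearMap.apply ℂ H x).continuous.comp
          (continuous_shiftedPosPart A)).tendsto r).comp hlim
      simp only [h0] at h1
      exact (tendsto_nhds_unique h1 tendsto_const_nhds)
    · have : (0 : ℝ) ≤ 1 / ((n : ℝ) + 1) := by positivity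
      linarith
  have hU : Monotone fun n => (K n)ᗮ := fun m n hmn => Submodule.orthogonal_le (hanti hmn)
  have key := Submodule.starProjection_tendsto_closure_iSup (fun n => (K n)ᗮ) hU ψ
  have hcl : (⨆ n, (K n)ᗮ).topologicalClosure = (spectralSubspace A r)ᗮ := by
    rw [← Submodule.orthogonal_orthogonal_eq_closure, ← Submodule.iInf_orthogonal, ← hinf]
    congr 1
    refine iInf_congr fun n => ?_
    exact Submodule.orthogonal_orthogonal _
  simp only [hcl, Submodule.starProjection_orthogonal_val] at key
  simpa [spectralProj, hK] using (tendsto_const_nhds (x := ψ)).sub key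

/-- The distribution function `F_ψ^A : r ↦ ⟨E_{(-∞, r]}⟩_ψ`. -/
def distFun (A : BddObservable H) (p : ℙ ℂ H) : StieltjesFunction ℝ where
  toFun r := meanValue (spectralProj A r) p
  mono' := meanValue_spectralProj_mono A p
  right_continuous' r := by
    have hmono := meanValue_spectralProj_mono A p
    rw [← continuousWithinAt_Ioi_iff_Ici]
    have h1 := hmono.tendsto_nhdsGT r
    have hlim : Tendsto (fun n : ℕ => r + 1 / ((n : ℝ) + 1)) atTop (𝓝[>] r) := by
      refine tendsto_nhdsWithin_iff.2 ⟨?_, Eventually.of_forall fun n => ?_⟩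
      · simpa using tendsto_const_nhds.add (tendsto_one_div_add_atTop_nhds_zero_nat (𝕜 := ℝ))
      · have : (0 : ℝ) < 1 / ((n : ℝ) + 1) := by positivity
        simpa using this
    have h2 : Tendsto (fun n : ℕ => meanValue (spectralProj A (r + 1 / ((n : ℝ) + 1))) p) atTop
        (𝓝 (meanValue (spectralProj A r) p)) := by
      induction p with | h ψ hψ =>
      simp only [meanValue_spectralProj]
      exact (((tendsto_spectralProj A ψ r).norm).pow 2).div_const _
    have h3 := tendsto_nhds_unique (h1.comp hlim) h2
    rw [ContinuousWithinAt, ← h3]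
    exact h1

end Observables

/-! ### Barriers, observable functions and representations -/

/-- The quasi-inverse `F^{(-1)} : ]0,1[ → ℝ`, `s ↦ min {r | s ≤ F r}`. For a right-continuous
non-decreasing `F` with infimum `0` and supremum `1` the infimum below is a minimum. -/
def quasiInverse (F : ℝ → ℝ) (s : Ioo (0 : ℝ) 1) : ℝ :=
  sInf {r : ℝ | (s : ℝ) ≤ F r}

variable {H : Type*} [NormedAddCommGroup H] [InnerProductSpace ℂ H] [CompleteSpace H]
variable {Z : Type*} [MeasurableSpace Z]

/-- A probability barrier associated to a state with law `μ` on the labels: a Borel function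
`α : Z → ]0,1[` that carries `μ` to the Lebesgue measure of `]0,1[`. -/
structure IsBarrier (μ : Measure Z) (α : Z → Ioo (0 : ℝ) 1) : Prop where
  measurable : Measurable α
  map_eq : μ.map α = (volume : Measure ℝ).comap ((↑) : Ioo (0 : ℝ) 1 → ℝ)

/-- A complex of barriers: a barrier `α A [ψ]` for `[ψ]`, for every observable `A` and every pure
state `[ψ]`. -/
def IsBarrierComplex (μ : ℙ ℂ H → Measure Z)
    (α : Observable H → ℙ ℂ H → Z → Ioo (0 : ℝ) 1) : Prop :=
  ∀ A p, IsBarrier (μ p) (α A p)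

/-- The function `Â_α ([ψ], z) = (F_ψ^A)^{(-1)} (α_[ψ]^A (z))` of a bounded observable `A`. -/
def valuesFun (α : Observable H → ℙ ℂ H → Z → Ioo (0 : ℝ) 1) (A : BddObservable H) :
    ℙ ℂ H × Z → ℝ :=
  fun x => quasiInverse (distFun A x.1) (α A.toObservable x.1 x.2)

/-- Equivalence of functions on `ℙ(H) × Z`: on each fibre they agree almost everywhere. -/
def FibrewiseAEEq (μ : ℙ ℂ H → Measure Z) (f g : ℙ ℂ H × Z → ℝ) : Prop :=
  ∀ p, (fun z => f (p, z)) =ᵐ[μ p] fun z => g (p, z)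

/-- A representation of `Ω_b` with functions on `(Z, μ_·)`: every `T A [ψ]` is Borel and
essentially bounded, and its law under `μ_[ψ]` is the Lebesgue–Stieltjes measure of `F_ψ^A`. -/
structure IsRepresentation (μ : ℙ ℂ H → Measure Z) (T : BddObservable H → ℙ ℂ H × Z → ℝ) :
    Prop where
  measurable : ∀ A p, Measurable fun z => T A (p, z)
  essBounded : ∀ A p, ∃ C : ℝ, ∀ᵐ z ∂(μ p), |T A (p, z)| ≤ C
  map_eq : ∀ A p, (μ p).map (fun z => T A (p, z)) = (distFun A p).measure

end QuantumBarrier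

end

/-! A complex of barriers carries no compatibility condition, so the problem splits into one problem
for each pair `(A, [ψ])`: given Borel `f` on `Z` whose law has distribution function `F`, find a
uniform `α` with `f = F^(-1) ∘ α` almost everywhere.

If `F` is continuous, `α = F ∘ f` works up to a null set. Atoms of the law make `F ∘ f` jump, so
ties are broken by an injective Borel map `e : Z → ]0,1[`: `lexRank` is the mass of the
lexicographic initial segment ending at `z`. As `μ` has no atoms, such segments attain every mass in
`]0,1[` (`exists_lexSegment`), which makes the rank uniform (`map_lexRank`).

Only one further property of the rank is needed: `α ≤ F ∘ f`. It gives `F^(-1) ∘ α ≤ f`; both sides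
have distribution function `F`, and two ordered functions with the same law agree almost everywhere
(`ae_eq_quasiInverse`). -/

namespace QuantumBarrier

/-! ### Quasi-inverses of distribution functions -/

/-- The infimum defining the quasi-inverse of a distribution function is a minimum: the
quasi-inverse is the lower adjoint of the distribution function. -/
lemma quasiInverse_le_iff (F : StieltjesFunction ℝ) (h0 : Tendsto F atBot (𝓝 0))
    (h1 : Tendsto F atTop (𝓝 1)) (s : Ioo (0 : ℝ) 1) (r : ℝ) :
    quasiInverse F s ≤ r ↔ (s : ℝ) ≤ F r := by
  obtain ⟨b, hb⟩ := (h0.eventually (gt_mem_nhds s.2.1)).exists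
  obtain ⟨c, hc⟩ := (h1.eventually (lt_mem_nhds s.2.2)).exists
  have hbdd : BddBelow {x : ℝ | (s : ℝ) ≤ F x} :=
    ⟨b, fun x hx => le_of_not_gt fun hxb => (hx.trans (F.mono hxb.le)).not_gt hb⟩
  have hne : {x : ℝ | (s : ℝ) ≤ F x}.Nonempty := ⟨c, hc.le⟩
  refine ⟨fun h => ?_, fun h => csInf_le hbdd h⟩
  -- The infimum is attained by right continuity: `s ≤ F y` for every `y > r`.
  refine ge_of_tendsto (((F.right_continuous r).mono Ioi_subset_Ici_self).tendsto) ?_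
  filter_upwards [self_mem_nhdsWithin] with y hy
  obtain ⟨x, hx, hxy⟩ := exists_lt_of_csInf_lt hne (lt_of_le_of_lt h hy)
  exact le_trans hx (F.mono hxy.le)

/-- Every level in `]0,1[` is crossed by the law of a real random variable at some value. -/
lemma exists_measureReal_Iio_le_le_measureReal_Iic (ν : Measure ℝ) [IsProbabilityMeasure ν]
    {t : ℝ} (ht : t ∈ Ioo (0 : ℝ) 1) : ∃ r, ν.real (Iio r) ≤ t ∧ t ≤ ν.real (Iic r) := by
  have h0 := ProbabilityTheory.tendsto_cdf_atBot ν
  have key := quasiInverse_le_iff _ h0 (ProbabilityTheory.tendsto_cdf_atTop ν) ⟨t, ht⟩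
  refine ⟨quasiInverse (ProbabilityTheory.cdf ν) ⟨t, ht⟩, ?_, ?_⟩
  · set r := quasiInverse (ProbabilityTheory.cdf ν) ⟨t, ht⟩
    have h : ν (Iio r) ≤ ENNReal.ofReal t := by
      rw [← ProbabilityTheory.measure_cdf ν, StieltjesFunction.measure_Iio _ h0, sub_zero]
      refine ENNReal.ofReal_le_ofReal ?_
      -- The mass of `Iio r` is the left limit of the cdf at the quantile `r`, and the cdf stays
      -- below `t` to the left of `r`.
      refine le_of_tendsto ((ProbabilityTheory.cdf ν).mono.tendsto_leftLim r) ?_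
      filter_upwards [self_mem_nhdsWithin] with y hy
      exact (not_le.1 fun h => (not_lt.2 ((key y).2 h)) hy).le
    exact ENNReal.toReal_le_of_le_ofReal ht.1.le h
  · rw [← ProbabilityTheory.cdf_eq_real]
    exact (key _).1 le_rfl

/-- Up to a constant, the distribution function is the primitive of `1` against `m`, and primitives
against an atomless measure are continuous. -/
lemma continuous_measureReal_Iic (m : Measure ℝ) [IsFiniteMeasure m] [NullSingletonClass m] :
    Continuous fun x => m.real (Iic x) := by
  have hint : ∀ a b : ℝ, IntervalIntegrable (fun _ => (1 : ℝ)) m a b := fun a b =>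
    intervalIntegrable_const
  have h := (intervalIntegral.continuous_primitive hint 0).const_add (m.real (Iic 0))
  refine h.congr fun x => ?_
  rw [← intervalIntegral.integral_Iic_sub_Iic (integrable_const _).integrableOn
    (integrable_const _).integrableOn]
  simp

/-- The Lebesgue measure of the unit interval is determined by its distribution function. -/
lemma map_eq_restrict_Ioo {Z : Type*} [MeasurableSpace Z] (μ : Measure Z)
    [IsProbabilityMeasure μ] {G : Z → ℝ} (hG : Measurable G) (hI : ∀ z, G z ∈ Icc (0 : ℝ) 1)
    (hle : ∀ t ∈ Ioo (0 : ℝ) 1, t ≤ μ.real {z | G z ≤ t})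
    (hlt : ∀ t ∈ Ioo (0 : ℝ) 1, μ.real {z | G z < t} ≤ t) :
    μ.map G = (volume : Measure ℝ).restrict (Ioo 0 1) := by
  -- For `s > t` the set `{G ≤ t}` lies in `{G < s}`, of mass at most `s`; let `s` decrease to `t`.
  have hmid : ∀ t ∈ Ioo (0 : ℝ) 1, μ.real {z | G z ≤ t} = t := fun t ht => by
    refine le_antisymm (le_of_forall_gt_imp_ge_of_dense fun s hs => ?_) (hle t ht)
    rcases lt_or_ge s 1 with h1 | h1
    · exact (measureReal_mono fun z (hz : G z ≤ t) => lt_of_le_of_lt hz hs).trans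
        (hlt s ⟨ht.1.trans hs, h1⟩)
    · exact measureReal_le_one.trans h1
  have hzero : ∀ t ≤ (0 : ℝ), μ.real {z | G z ≤ t} = 0 := fun t ht => by
    refine le_antisymm (le_of_forall_gt_imp_ge_of_dense fun s hs => ?_) measureReal_nonneg
    rcases lt_or_ge s 1 with h1 | h1
    · exact (measureReal_mono fun z (hz : G z ≤ t) => (hz.trans (ht.trans hs.le))).trans
        (hmid s ⟨hs, h1⟩).le
    · exact measureReal_le_one.trans h1
  have : IsProbabilityMeasure (μ.map G) := Measure.isProbabilityMeasure_map hG.aemeasurable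
  refine Measure.ext_of_Iic _ _ fun t => ?_
  rw [Measure.map_apply hG measurableSet_Iic, Measure.restrict_apply measurableSet_Iic,
    ← ENNReal.toReal_eq_toReal_iff' (measure_ne_top _ _)
      (measure_ne_top_of_subset inter_subset_right (by simp))]
  change μ.real {z | G z ≤ t} = volume.real (Iic t ∩ Ioo 0 1)
  rcases le_or_gt t 0 with h0 | h0
  · rw [hzero t h0, show Iic t ∩ Ioo (0 : ℝ) 1 = ∅ by
      ext x; simp only [mem_inter_iff, mem_Iic, mem_Ioo, mem_empty_iff_false, iff_false]
      intro h; linarith [h.1, h.2.1]]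
    simp
  rcases lt_or_ge t 1 with h1 | h1
  · rw [hmid t ⟨h0, h1⟩, show Iic t ∩ Ioo (0 : ℝ) 1 = Ioc 0 t by
      ext x; simp only [mem_inter_iff, mem_Iic, mem_Ioo, mem_Ioc]
      exact ⟨fun h => ⟨h.2.1, h.1⟩, fun h => ⟨h.2, h.1, h.2.trans_lt h1⟩⟩]
    simp [h0.le]
  · rw [show Iic t ∩ Ioo (0 : ℝ) 1 = Ioo 0 1 by
        rw [inter_eq_right]; exact fun x hx => hx.2.le.trans h1,
      show {z | G z ≤ t} = univ from eq_univ_of_forall fun z => (hI z).2.trans h1]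
    simp

/-! ### The lexicographic distributional transform -/

section LexRank

variable {Z : Type*} [MeasurableSpace Z]

/-- The mass of the labels that precede `z` when labels are ordered by `f`, ties being broken
by `e`. -/
def lexRank (μ : Measure Z) (f e : Z → ℝ) (z : Z) : ℝ :=
  μ.real {w | f w < f z ∨ f w = f z ∧ e w ≤ e z}

variable {μ : Measure Z} [IsProbabilityMeasure μ] {f e : Z → ℝ}

lemma measurable_lexRank (hf : Measurable f) (he : Measurable e) :
    Measurable (lexRank μ f e) := by
  have hs : MeasurableSet {p : Z × Z | f p.2 < f p.1 ∨ f p.2 = f p.1 ∧ e p.2 ≤ e p.1} :=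
    (measurableSet_lt (hf.comp measurable_snd) (hf.comp measurable_fst)).union
      ((measurableSet_eq_fun (hf.comp measurable_snd) (hf.comp measurable_fst)).inter
        (measurableSet_le (he.comp measurable_snd) (he.comp measurable_fst)))
  exact (measurable_measure_prodMk_left (ν := μ) hs).ennreal_toReal

lemma lexRank_mem_Icc (z : Z) : lexRank μ f e z ∈ Icc (0 : ℝ) 1 :=
  ⟨measureReal_nonneg, measureReal_le_one⟩

lemma lexRank_le (z : Z) : lexRank μ f e z ≤ μ.real {w | f w ≤ f z} :=
  measureReal_mono fun _ h => h.elim le_of_lt fun h => h.1.le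

/-- Every level in `]0,1[` is the mass of a lexicographic initial segment. -/
lemma exists_lexSegment [NullSingletonClass μ] (hf : Measurable f) (he : Measurable e)
    (hinj : Function.Injective e) (hI : ∀ z, e z ∈ Ioo (0 : ℝ) 1) {t : ℝ}
    (ht : t ∈ Ioo (0 : ℝ) 1) :
    ∃ r x : ℝ, μ.real {w | f w < r ∨ f w = r ∧ e w ≤ x} = t := by
  have : IsProbabilityMeasure (μ.map f) := Measure.isProbabilityMeasure_map hf.aemeasurable
  obtain ⟨r, hr1, hr2⟩ := exists_measureReal_Iio_le_le_measureReal_Iic (μ.map f) ht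
  rw [map_measureReal_apply hf measurableSet_Iio] at hr1
  rw [map_measureReal_apply hf measurableSet_Iic] at hr2
  -- The mass of the tie set `{f = r}`, spread over the line by the tie-breaker. Fibres of `e` have
  -- at most one point, so `m` inherits atomlessness from `μ`.
  set m : Measure ℝ := (μ.restrict (f ⁻¹' {r})).map e with hm
  have hr : MeasurableSet (f ⁻¹' {r}) := hf (measurableSet_singleton r)
  have : NullSingletonClass m := ⟨fun x => by
    rw [hm, Measure.map_apply he (measurableSet_singleton x)]
    refine measure_mono_null (Subset.refl _) ?_
    refine le_antisymm ((Measure.restrict_apply_le _ _).trans ?_) bot_le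
    exact (Set.Subsingleton.measure_zero
      (fun a ha b hb => hinj ((ha : e a = x).trans (hb : e b = x).symm)) μ).le⟩
  have hmass : ∀ x, μ.real {w | f w < r ∨ f w = r ∧ e w ≤ x} =
      μ.real (f ⁻¹' Iio r) + m.real (Iic x) := fun x => by
    rw [hm, map_measureReal_apply he measurableSet_Iic,
      measureReal_restrict_apply (he measurableSet_Iic),
      ← measureReal_union _ ((he measurableSet_Iic).inter hr)]
    · congr 1
      ext w
      simp [and_comm]
    · refine Set.disjoint_left.2 fun w h1 h2 => ?_
      exact (h1 : f w < r).ne h2.2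
  have hcont : Continuous fun x => μ.real (f ⁻¹' Iio r) + m.real (Iic x) :=
    (continuous_measureReal_Iic m).const_add _
  -- Since `e` takes values in `]0,1[`, the segment is `{f < r}` at `x = 0` and `{f ≤ r}` at `x =
  -- 1`; their masses enclose `t`.
  obtain ⟨x, -, hx⟩ := intermediate_value_Icc (zero_le_one' ℝ) hcont.continuousOn
    (show t ∈ Icc _ _ by
      simp only [← hmass]
      refine ⟨(measureReal_mono fun w hw => ?_).trans hr1,
        hr2.trans (measureReal_mono fun w hw => ?_)⟩
      · exact hw.resolve_right fun h => (hI w).1.not_ge h.2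
      · exact (lt_or_eq_of_le (show f w ≤ r from hw)).imp_right fun h => ⟨h, (hI w).2.le⟩)
  exact ⟨r, x, (hmass x).trans hx⟩

/-- The lexicographic rank is uniformly distributed on the unit interval. -/
lemma map_lexRank [NullSingletonClass μ] (hf : Measurable f) (he : Measurable e)
    (hinj : Function.Injective e) (hI : ∀ z, e z ∈ Ioo (0 : ℝ) 1) :
    μ.map (lexRank μ f e) = (volume : Measure ℝ).restrict (Ioo 0 1) := by
  refine map_eq_restrict_Ioo μ (measurable_lexRank hf he) lexRank_mem_Icc (fun t ht => ?_)
    fun t ht => ?_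
  all_goals obtain ⟨r, x, hrx⟩ := exists_lexSegment (μ := μ) hf he hinj hI ht
  -- Let `S` be the segment of mass `t`. A point of `S` has all its predecessors in `S`, hence rank
  -- at most `t`.
  · rw [← hrx]
    refine measureReal_mono fun z hz => ?_
    refine measureReal_mono fun w hw => ?_
    simp only [mem_ofPred_eq] at hz hw ⊢
    grind
  -- The order is total, so a point outside `S` is preceded by all of `S` and has rank at least `t`.
  · conv_rhs => rw [← hrx]
    refine measureReal_mono fun z (hz : lexRank μ f e z < t) => ?_
    by_contra hzS
    refine hz.not_ge ?_
    rw [← hrx]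
    refine measureReal_mono fun w hw => ?_
    simp only [mem_ofPred_eq] at hzS hw ⊢
    grind

end LexRank

/-! ### Barriers -/

section Barriers

variable {Z : Type*} [MeasurableSpace Z]

/-- Ranks are real-valued while barriers live on the subtype; the inclusion is a measurable
embedding, so its pushforward loses no information. -/
lemma isBarrier_of_map_val_eq {μ : Measure Z} {α : Z → Ioo (0 : ℝ) 1} (hα : Measurable α)
    (h : μ.map (fun z => (α z : ℝ)) = (volume : Measure ℝ).restrict (Ioo 0 1)) :
    IsBarrier μ α := by
  refine ⟨hα, ?_⟩
  have hv : MeasurableEmbedding ((↑) : Ioo (0 : ℝ) 1 → ℝ) :=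
    MeasurableEmbedding.subtype_coe measurableSet_Ioo
  rw [← hv.comap_map (μ.map α), Measure.map_map hv.measurable hα]
  change (μ.map (fun z => (α z : ℝ))).comap _ = _
  rw [h, ← map_comap_subtype_coe measurableSet_Ioo, hv.comap_map]

/-- On an atomless standard Borel probability space, every Borel function `f` admits a barrier
lying almost everywhere below the distribution function of `f` evaluated at `f`. -/
lemma exists_isBarrier_le [StandardBorelSpace Z] (μ : Measure Z) [IsProbabilityMeasure μ]
    [NullSingletonClass μ] {f : Z → ℝ} (hf : Measurable f) :
    ∃ α : Z → Ioo (0 : ℝ) 1, IsBarrier μ α ∧ ∀ᵐ z ∂μ, (α z : ℝ) ≤ μ.real {w | f w ≤ f z} := by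
  set e : Z → ℝ := fun z => Real.sigmoid (embeddingReal Z z)
  have hemb := measurableEmbedding_embeddingReal Z
  have he : Measurable e := Real.sigmoid_strictMono.monotone.measurable.comp hemb.measurable
  have hinj : Function.Injective e := Real.sigmoid_strictMono.injective.comp hemb.injective
  have hI : ∀ z, e z ∈ Ioo (0 : ℝ) 1 := fun z => ⟨Real.sigmoid_pos _, Real.sigmoid_lt_one _⟩
  have hmap := map_lexRank (μ := μ) hf he hinj hI
  have hmeas : Measurable (lexRank μ f e) := measurable_lexRank hf he
  have hae : ∀ᵐ z ∂μ, lexRank μ f e z ∈ Ioo (0 : ℝ) 1 := by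
    refine ae_of_ae_map hmeas.aemeasurable (p := fun x => x ∈ Ioo (0 : ℝ) 1) ?_
    rw [hmap]
    exact ae_restrict_mem measurableSet_Ioo
  classical
  -- The value `1 / 2` is arbitrary: it is used only on the null set where the rank is `0` or `1`.
  have hmem : ∀ z, (if lexRank μ f e z ∈ Ioo (0 : ℝ) 1 then lexRank μ f e z else 1 / 2) ∈
      Ioo (0 : ℝ) 1 := fun z => by
    split_ifs with h
    · exact h
    · norm_num
  set α : Z → Ioo (0 : ℝ) 1 := fun z => ⟨_, hmem z⟩
  have hαm : Measurable α :=
    (Measurable.ite (hmeas measurableSet_Ioo) hmeas measurable_const).subtype_mk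
  have hαe : (fun z => (α z : ℝ)) =ᵐ[μ] lexRank μ f e := by
    filter_upwards [hae] with z hz
    exact if_pos hz
  refine ⟨α, isBarrier_of_map_val_eq hαm ((Measure.map_congr hαe).trans hmap), ?_⟩
  filter_upwards [hαe] with z hz
  rw [hz]
  exact lexRank_le z

lemma IsBarrier.measure_le {μ : Measure Z} {α : Z → Ioo (0 : ℝ) 1} (hα : IsBarrier μ α) {t : ℝ}
    (ht : t ∈ Icc (0 : ℝ) 1) : μ {z | (α z : ℝ) ≤ t} = ENNReal.ofReal t := by
  have hs : MeasurableSet {x : Ioo (0 : ℝ) 1 | (x : ℝ) ≤ t} :=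
    measurableSet_le measurable_subtype_coe measurable_const
  have h := congrArg (fun m : Measure (Ioo (0 : ℝ) 1) => m {x | (x : ℝ) ≤ t}) hα.map_eq
  simp only [Measure.map_apply hα.measurable hs,
    (MeasurableEmbedding.subtype_coe (measurableSet_Ioo (a := (0 : ℝ)) (b := 1))).comap_apply] at h
  refine Eq.trans h ?_
  -- Deleting `1` matters only for `t = 1`, a value that `α` never exceeds or attains.
  rw [show ((↑) : Ioo (0 : ℝ) 1 → ℝ) '' {x | (x : ℝ) ≤ t} = Ioc 0 t \ {1} by
    ext x
    simp only [mem_image, mem_ofPred_eq, Subtype.exists, mem_Ioo, Set.mem_sdiff, mem_Ioc,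
      mem_singleton_iff, exists_and_left, exists_prop, exists_eq_right_right]
    exact ⟨fun h => ⟨⟨h.2.1, h.1⟩, h.2.2.ne⟩,
      fun h => ⟨h.1.2, h.1.1, lt_of_le_of_ne (h.1.2.trans ht.2) h.2⟩⟩,
    measure_sdiff_null (by simp)]
  simp

/-- A barrier below `F ∘ f`, where `F` is the distribution function of `f`, recovers `f` through
the quasi-inverse of `F`. -/
lemma ae_eq_quasiInverse {μ : Measure Z} [IsProbabilityMeasure μ] {f : Z → ℝ} (hf : Measurable f)
    (F : StieltjesFunction ℝ) (h0 : Tendsto F atBot (𝓝 0)) (h1 : Tendsto F atTop (𝓝 1))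
    (hF : ∀ r, μ.real {w | f w ≤ r} = F r) {α : Z → Ioo (0 : ℝ) 1} (hα : IsBarrier μ α)
    (hle : ∀ᵐ z ∂μ, (α z : ℝ) ≤ μ.real {w | f w ≤ f z}) :
    ∀ᵐ z ∂μ, f z = quasiInverse F (α z) := by
  -- Almost everywhere `{f ≤ q}` is contained in `{α ≤ F q}`, and both have mass `F q`, so they
  -- differ by a null set. Rational `q` keeps the exceptional sets countable in number.
  have key : ∀ q : ℚ, ∀ᵐ z ∂μ, (α z : ℝ) ≤ F q → f z ≤ q := fun q => by
    have hsub : {z | f z ≤ q} ≤ᵐ[μ] {z | (α z : ℝ) ≤ F q} := by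
      filter_upwards [hle] with z hz (hq : f z ≤ q)
      exact hz.trans ((hF _).le.trans (F.mono hq))
    have hmem : F q ∈ Icc (0 : ℝ) 1 := by
      rw [← hF]; exact ⟨measureReal_nonneg, measureReal_le_one⟩
    have heq := ae_eq_of_ae_subset_of_measure_ge hsub
      (by rw [hα.measure_le hmem, ← hF, ofReal_measureReal])
      (measurableSet_le hf measurable_const).nullMeasurableSet (measure_ne_top _ _)
    filter_upwards [heq.mem_iff] with z hz h
    exact hz.2 h
  filter_upwards [hle, ae_all_iff.2 key] with z hz hq
  refine le_antisymm (le_of_forall_gt_imp_ge_of_dense fun s hs => ?_) ?_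
  · obtain ⟨q, hq1, hq2⟩ := exists_rat_btwn hs
    exact (hq q ((quasiInverse_le_iff F h0 h1 _ _).1 hq1.le)).trans hq2.le
  · rw [quasiInverse_le_iff F h0 h1, ← hF]
    exact hz

end Barriers

/-! ### The distribution functions of an observable -/

section Observables

variable {H : Type*} [NormedAddCommGroup H] [InnerProductSpace ℂ H] [CompleteSpace H]

lemma distFun_mem_Icc (A : BddObservable H) (p : ℙ ℂ H) (r : ℝ) :
    distFun A p r ∈ Icc (0 : ℝ) 1 := by
  induction p with | h ψ hψ =>
  change meanValue (spectralProj A r) (Projectivization.mk ℂ ψ hψ) ∈ Icc (0 : ℝ) 1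
  rw [meanValue_spectralProj]
  refine ⟨by positivity, div_le_one_of_le₀ ?_ (by positivity)⟩
  have h : ‖spectralProj A r ψ‖ ≤ ‖ψ‖ := Submodule.norm_starProjection_apply_le _ _
  gcongr

/-- If the Lebesgue–Stieltjes measure of a `[0,1]`-valued `F` is a probability measure, then
`F` increases from `0` to `1`. -/
lemma tendsto_of_isProbabilityMeasure (F : StieltjesFunction ℝ) (hF : ∀ r, F r ∈ Icc (0 : ℝ) 1)
    [IsProbabilityMeasure F.measure] : Tendsto F atBot (𝓝 0) ∧ Tendsto F atTop (𝓝 1) := by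
  have hb := tendsto_atBot_ciInf F.mono ⟨0, by rintro _ ⟨r, rfl⟩; exact (hF r).1⟩
  have ht := tendsto_atTop_ciSup F.mono ⟨1, by rintro _ ⟨r, rfl⟩; exact (hF r).2⟩
  have hb0 : 0 ≤ ⨅ r, F r := le_ciInf fun r => (hF r).1
  have ht1 : ⨆ r, F r ≤ 1 := ciSup_le fun r => (hF r).2
  -- Supremum minus infimum is `1` while both lie in `[0,1]`, which forces the values `1` and `0`.
  have h := F.measure_univ hb ht
  rw [measure_univ, eq_comm, ENNReal.ofReal_eq_one] at h
  rw [show (⨅ r, F r) = 0 by linarith] at hb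
  rw [show (⨆ r, F r) = 1 by linarith] at ht
  exact ⟨hb, ht⟩

lemma BddObservable.toObservable_injective :
    Function.Injective (BddObservable.toObservable (H := H)) := by
  intro A B h
  refine Subtype.ext (ContinuousLinearMap.ext fun x => ?_)
  have h' : (A.1 : H →ₗ[ℂ] H).toPMap ⊤ = (B.1 : H →ₗ[ℂ] H).toPMap ⊤ := congrArg Subtype.val h
  have h2 := (LinearPMap.ext_iff.1 h').2
  exact @h2 x trivial trivial

end Observables

end QuantumBarrier

theorem mainTheorem5
    {H : Type*} [NormedAddCommGroup H] [InnerProductSpace ℂ H] [CompleteSpace H]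
    [TopologicalSpace.SeparableSpace H] (hH : ¬ FiniteDimensional ℂ H)
    {Z : Type*} [MeasurableSpace Z] [StandardBorelSpace Z] [Uncountable Z]
    (μ : ℙ ℂ H → Measure Z) [∀ p, IsProbabilityMeasure (μ p)] [∀ p, NullSingletonClass (μ p)]
    (T : QuantumBarrier.BddObservable H → ℙ ℂ H × Z → ℝ)
    (hT : QuantumBarrier.IsRepresentation μ T) :
    ∃ α : QuantumBarrier.Observable H → ℙ ℂ H → Z → Ioo (0 : ℝ) 1,
      QuantumBarrier.IsBarrierComplex μ α ∧
        ∀ A : QuantumBarrier.BddObservable H,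
          QuantumBarrier.FibrewiseAEEq μ (T A) (QuantumBarrier.valuesFun α A) := by
  have key : ∀ (O : QuantumBarrier.Observable H) (p : ℙ ℂ H), ∃ α : Z → Ioo (0 : ℝ) 1,
      QuantumBarrier.IsBarrier (μ p) α ∧ ∀ A : QuantumBarrier.BddObservable H,
        A.toObservable = O →
          ∀ᵐ z ∂(μ p), T A (p, z) =
            QuantumBarrier.quasiInverse (QuantumBarrier.distFun A p) (α z) := by
    intro O p
    by_cases hO : ∃ A : QuantumBarrier.BddObservable H, A.toObservable = O
    · obtain ⟨A, rfl⟩ := hO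
      have hm := hT.measurable A p
      obtain ⟨α, hα, hle⟩ := QuantumBarrier.exists_isBarrier_le (μ p) hm
      refine ⟨α, hα, fun B hB => ?_⟩
      obtain rfl := QuantumBarrier.BddObservable.toObservable_injective hB
      have hmap := hT.map_eq B p
      -- The limits of `F` at `±∞` come from the representation itself: the Lebesgue–Stieltjes
      -- measure is the law of `T B`, hence has mass one.
      have : IsProbabilityMeasure (QuantumBarrier.distFun B p).measure :=
        hmap ▸ Measure.isProbabilityMeasure_map hm.aemeasurable
      obtain ⟨h0, h1⟩ := QuantumBarrier.tendsto_of_isProbabilityMeasure _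
        (QuantumBarrier.distFun_mem_Icc B p)
      refine QuantumBarrier.ae_eq_quasiInverse hm _ h0 h1 (fun r => ?_) hα hle
      change (μ p).real ((fun z => T B (p, z)) ⁻¹' Iic r) = _
      rw [← map_measureReal_apply hm measurableSet_Iic, hmap, measureReal_def,
        StieltjesFunction.measure_Iic _ h0, sub_zero,
        ENNReal.toReal_ofReal (QuantumBarrier.distFun_mem_Icc B p r).1]
    -- For an observable outside `Ω_b` any barrier will do; the one built from a constant function
    -- shows that barriers exist.
    · obtain ⟨α, hα, -⟩ := QuantumBarrier.exists_isBarrier_le (μ p)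
        (measurable_const (a := (0 : ℝ)))
      exact ⟨α, hα, fun A hA => (hO ⟨A, hA⟩).elim⟩
  choose α hα h using key
  exact ⟨α, hα, fun A p => h A.toObservable p A rfl⟩
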